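/- Let $D$ be a link diagram in the plane that is connected (its projection graph, obtained by replacing each crossing with a 4-valent vertex, is connected), has at least one crossing, and is checkerboard-colored (each region is black or white so that at each crossing two opposite corners are black and the other two are white). Let $\sigma$ be a state of $D$, that is, a choice of the A-resolution or the B-resolution at each crossing; the A-resolution joins the two corners that the overstrand sweeps when it is turned counterclockwise, and the B-resolution joins the other two. Resolving all crossings according to $\sigma$ gives a collection of state circles, together with one state segment for each crossing, joining the two strands that replace it. The diagram $D$ is called $\sigma$-adequate if no state segment connects a state circle to itself. The Tait graph $G$ of $D$ (loops and parallel edges allowed) has the black regions as its vertices and the crossings as its edges, where a crossing joins the black regions at its two black corners. An edge is labeled $+$ if the A-resolution of its crossing joins the two black corners, and $-$ otherwise. Let $E_\sigma \subseteq E(G)$ be the set of all $+$ edges whose crossings are A-resolved by $\sigma$ and all $-$ edges whose crossings are B-resolved by $\sigma$. Let $G|E_\sigma$ be the spanning subgraph of $G$ with edge set $E_\sigma$, let $G/E_\sigma$ be the graph obtained from $G$ by contracting the edges of $E_\sigma$ (contracting a loop means deleting it), and put $$\phi_D^\sigma(t)=\chi_{G|E_\sigma}(0,t)\cdot\chi_{G/E_\sigma}(t,0),$$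 where $\chi_H(x,y)=\sum_{A\subseteq E(H)}(x-1)^{k(H|A)-k(H)}(y-1)^{|A|+k(H|A)-|V(H)|}$ is the Tutte polynomial of a finite graph $H$ and $k$ is the number of connected components. Then $D$ is $\sigma$-adequate if and only if $\phi_D^\sigma(t)\neq 0$. -/

import Mathlib

/-! ### Graphs and the Tutte polynomial

Graphs are Mathlib's `Graph α β`: loops and parallel edges are allowed, and `G.restrict H` is the
spanning subgraph `G|H`. -/

namespace Graph

variable {α β : Type*}

/-- The equivalence relation "joined by a path of `G`". -/
def reachSetoid (G : Graph α β) : Setoid α :=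
  Relation.EqvGen.setoid G.Adj

/-- The number `k(G)` of connected components of `G`. -/
noncomputable def numComponents (G : Graph α β) : ℕ :=
  (Quotient.mk G.reachSetoid '' G.vertexSet).ncard

/-- The graph `G/H` obtained by contracting the edges in `H`: each connected component of `G|H`
becomes one vertex, and the edges of `H` disappear. -/
def contractEdges (G : Graph α β) (H : Set β) : Graph (Quotient (G.restrict H).reachSetoid) β :=
  (G.map (Quotient.mk (G.restrict H).reachSetoid)).deleteEdges H

/-- The Tutte polynomial of a finite graph `G`, as a polynomial in `x = X 0` and `y = X 1`:
`∑_{A ⊆ E(G)} (x - 1) ^ (k(G|A) - k(G)) * (y - 1) ^ (|A| + k(G|A) - |V(G)|)`.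
Both exponents are nonnegative for every finite graph, so the subtractions never truncate. -/
noncomputable def tutte (G : Graph α β) : MvPolynomial (Fin 2) ℤ :=
  ∑ᶠ A ∈ {A : Set β | A ⊆ G.edgeSet},
    (MvPolynomial.X 0 - 1) ^ ((G.restrict A).numComponents - G.numComponents) *
      (MvPolynomial.X 1 - 1) ^ (A.ncard + (G.restrict A).numComponents - G.vertexSet.ncard)

end Graph

/-! ### Link diagrams

A link diagram is encoded by its projection graph with the cyclic order of the strand ends at each
crossing, that is, as a planar diagram code. -/

/-- The four ends of strands at each crossing. At a crossing `c`, the ends `(c, 0)`, `(c, 1)`,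
`(c, 2)`, `(c, 3)` follow one another counterclockwise; `(c, 0)` and `(c, 2)` belong to the
understrand, `(c, 1)` and `(c, 3)` belong to the overstrand. The same pair `(c, i)` also names the
corner at `c` between the ends `(c, i)` and `(c, i + 1)`. -/
abbrev Dart (C : Type*) : Type _ := C × ZMod 4

/-- The permutation that sends an end to the next one counterclockwise at the same crossing. -/
def rot (C : Type*) : Equiv.Perm (Dart C) :=
  (Equiv.refl C).prodCongr (Equiv.addRight 1)

/-- A 4-valent graph with vertex set `C`, with a cyclic order of the ends at each vertex and
over/under information there. It is drawn on some closed oriented surface. -/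
structure DiagramCode (C : Type*) where
  /-- The end at the other side of the edge of the projection graph that starts with a given end. -/
  arc : Equiv.Perm (Dart C)
  arc_arc : ∀ d, arc (arc d) = d
  arc_ne : ∀ d, arc d ≠ d

namespace DiagramCode

variable {C : Type*} (D : DiagramCode C)

/-- The edges of the projection graph. -/
def Arc : Type _ := Quotient (Equiv.Perm.SameCycle.setoid D.arc)

/-- The regions. The corner `d` lies to the left of the edge that leaves the crossing through the
end `d`. Following this edge with the region on the left, one reaches the next crossing at the end
`arc d`, and the next corner of the region is `rot⁻¹ (arc d)`. So regions are the cycles of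
`rot⁻¹ * arc` on corners. (These are the complementary regions if the projection graph is
connected; in general they are the boundary curves of the regions.) -/
def Region : Type _ := Quotient (Equiv.Perm.SameCycle.setoid ((rot C)⁻¹ * D.arc))

/-- The region in which a corner lies. -/
def region (d : Dart C) : D.Region := Quotient.mk _ d

/-- Two crossings are equivalent if they are joined by a path in the projection graph. -/
def componentSetoid : Setoid C :=
  Relation.EqvGen.setoid fun c c' => ∃ i j, D.arc (c, i) = (c', j)

/-- The connected components of the projection graph. -/
def Component : Type _ := Quotient D.componentSetoid

end DiagramCode

/-- A link diagram with set of crossings `C`, in which every link component passes through a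
crossing (which holds for every connected diagram with at least one crossing). Planarity is Euler's
formula `V + F = E + 2 k`: each of the `k` components of the projection graph has genus zero. -/
structure LinkDiagram (C : Type*) extends DiagramCode C where
  finite_crossings : Finite C
  planar : Nat.card C + Nat.card toDiagramCode.Region =
    Nat.card toDiagramCode.Arc + 2 * Nat.card toDiagramCode.Component

/-- The two ways to resolve a crossing. -/
inductive Resolution
  | A
  | B

/-- How a resolution at a crossing reconnects the four ends there. Turning the overstrand
counterclockwise sweeps the corners `1` and `3`. The A-resolution joins these two corners, so it
connects the end `0` with `1` and `2` with `3`. The B-resolution joins the corners `0` and `2`, so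
it connects `1` with `2` and `3` with `0`. -/
def Resolution.reconnect : Resolution → ZMod 4 → ZMod 4
  | .A, i => 1 - i
  | .B, i => 3 - i

/-- The colors of a checkerboard coloring. -/
inductive Shade
  | black
  | white

namespace LinkDiagram

variable {C : Type*} (D : LinkDiagram C)

/-- The diagram is connected: any two crossings are joined by a path in the projection graph.
(Used together with the existence of a crossing.) -/
def Connected : Prop := ∀ c c' : C, D.componentSetoid c c'

/-- A state chooses a resolution at each crossing. -/
abbrev State (_ : LinkDiagram C) : Type _ := C → Resolution

/-- Two ends lie on the same state circle: state circles run along the edges of the projection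
graph and pass through each crossing as the chosen resolution prescribes. -/
def circleSetoid (σ : D.State) : Setoid (Dart C) :=
  Relation.EqvGen.setoid fun d d' => d' = D.arc d ∨ d' = (d.1, (σ d.1).reconnect d.2)

/-- The state circles of the state graph `H_σ`. -/
def StateCircle (σ : D.State) : Type _ := Quotient (D.circleSetoid σ)

/-- The state circles at the two ends of the state segment of `H_σ` at the crossing `c`. The segment
joins the two strands that replace the crossing; for both resolutions, `(c, 0)` belongs to one of
these strands and `(c, 2)` to the other. -/
def segmentEnds (σ : D.State) (c : C) : Sym2 (D.StateCircle σ) :=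
  s(Quotient.mk _ (c, 0), Quotient.mk _ (c, 2))

/-- `D` is `σ`-adequate: no state segment connects a state circle to itself. -/
def IsAdequate (σ : D.State) : Prop := ∀ c, ¬ (D.segmentEnds σ c).IsDiag

/-- A checkerboard coloring: each region is black or white, and at each crossing adjacent corners
have different colors (so two opposite corners are black and the other two are white). -/
structure Checkerboard where
  shade : D.Region → Shade
  shade_ne : ∀ d, shade (D.region d) ≠ shade (D.region (rot C d))

namespace Checkerboard

variable {D} (κ : D.Checkerboard)

theorem exists_black (c : C) :
    ∃ i : ZMod 4, κ.shade (D.region (c, i)) = .black ∧ κ.shade (D.region (c, i + 2)) = .black := by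
  have h : ∀ i : ZMod 4, κ.shade (D.region (c, i)) ≠ κ.shade (D.region (c, i + 1)) :=
    fun i => κ.shade_ne (c, i)
  have h0 := h 0
  have h1 := h 1
  have h2 := h 2
  have e1 : (0 : ZMod 4) + 1 = 1 := by decide
  have e2 : (1 : ZMod 4) + 1 = 2 := by decide
  have e3 : (2 : ZMod 4) + 1 = 3 := by decide
  have e4 : (0 : ZMod 4) + 2 = 2 := by decide
  have e5 : (1 : ZMod 4) + 2 = 3 := by decide
  rw [e1] at h0
  rw [e2] at h1
  rw [e3] at h2
  cases a0 : κ.shade (D.region (c, 0)) <;> cases a1 : κ.shade (D.region (c, 1)) <;>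
    cases a2 : κ.shade (D.region (c, 2)) <;> cases a3 : κ.shade (D.region (c, 3)) <;>
    first
      | exact absurd (a0.trans a1.symm) h0
      | exact absurd (a1.trans a2.symm) h1
      | exact absurd (a2.trans a3.symm) h2
      | exact ⟨0, a0, by rw [e4]; exact a2⟩
      | exact ⟨1, a1, by rw [e5]; exact a3⟩

theorem black_unique (c : C) {i j : ZMod 4} (hi : κ.shade (D.region (c, i)) = .black)
    (hj : κ.shade (D.region (c, j)) = .black) : j = i ∨ j = i + 2 := by
  have h1 := κ.shade_ne (c, i)
  have h2 := κ.shade_ne (c, j)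
  have r : ∀ k : ZMod 4, rot C (c, k) = (c, k + 1) := fun _ => rfl
  rw [r] at h1 h2
  have hij : j ≠ i + 1 := by
    rintro rfl
    exact h1 (hi.trans hj.symm)
  have hji : i ≠ j + 1 := by
    rintro rfl
    exact h2 (hj.trans hi.symm)
  clear h1 h2 hi hj r
  revert i j
  decide

/-- The Tait graph: its vertices are the black regions, its edges are the crossings, and the edge
`c` joins the black regions at the two opposite black corners of the crossing `c` (it is a loop if
these two corners lie in the same region). -/
def tait : Graph D.Region C where
  vertexSet := {r | κ.shade r = .black}
  IsLink c r s := ∃ i : ZMod 4, r = D.region (c, i) ∧ s = D.region (c, i + 2) ∧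
    κ.shade r = .black ∧ κ.shade s = .black
  edgeSet := Set.univ
  isLink_symm := by
    rintro c -
    refine ⟨?_⟩
    rintro r s ⟨i, hr, hs, hbr, hbs⟩
    have e : i + 2 + 2 = i := by
      clear hr hs
      revert i
      decide
    exact ⟨i + 2, hs, by rw [e]; exact hr, hbs, hbr⟩
  eq_or_eq_of_isLink_of_isLink := by
    rintro c x y v w ⟨i, hx, hy, hbx, hby⟩ ⟨j, hv, hw, hbv, hbw⟩
    subst hx hy hv hw
    rcases κ.black_unique c hbv hbx with h | h
    · exact Or.inl (by rw [h])
    · exact Or.inr (by rw [h])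
  edge_mem_iff_exists_isLink := by
    intro c
    obtain ⟨i, h1, h2⟩ := κ.exists_black c
    exact ⟨fun _ => ⟨_, _, i, rfl, rfl, h1, h2⟩, fun _ => trivial⟩
  left_mem_of_isLink := by
    rintro c r s ⟨i, -, -, h, -⟩
    exact h

/-- The edge `c` of the Tait graph has sign `+` if the black corners at `c` are those which the
overstrand sweeps when it is turned counterclockwise (equivalently, those which the A-resolution
joins), and sign `-` otherwise. -/
def IsPositive (c : C) : Prop := κ.shade (D.region (c, 1)) = .black

/-- The set `E_σ` of the `+` edges at A-resolved crossings and the `-` edges at B-resolved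
crossings. -/
def edgeSubset (σ : D.State) : Set C :=
  {c | (κ.IsPositive c ∧ σ c = .A) ∨ (¬ κ.IsPositive c ∧ σ c = .B)}

/-- The polynomial `φ_D^σ(t) = χ_{G|E_σ}(0, t) * χ_{G/E_σ}(t, 0)`, where `G` is the Tait graph and
`χ` is the Tutte polynomial. -/
noncomputable def phi (σ : D.State) : Polynomial ℤ :=
  MvPolynomial.aeval ![0, Polynomial.X] (κ.tait.restrict (κ.edgeSubset σ)).tutte *
    MvPolynomial.aeval ![Polynomial.X, 0] (κ.tait.contractEdges (κ.edgeSubset σ)).tutte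

end Checkerboard

end LinkDiagram

/-! Thicken the black regions to disks and attach a band at each crossing of a set `A`. For `A =
E_σ` the boundary curves of this surface are the state circles (`sameCycle_walk_edgeSubset_iff`),
and its components are those of `G|A`. The boundary is encoded as a permutation `walk A` of the
edges directed with black on the left; a new band at `c` multiplies it by the transposition of the
two black corners of `c` (`walk_insert`), so it splits one boundary curve or merges two.

Planarity forces genus zero. The quantity `excess` never decreases when a band is added, and Euler's
formula bounds its value for all bands by its value for none, so it is constant. Hence the black
corners of a crossing outside `A` lie on one boundary curve exactly when they lie in one component
(`sameCycle_walk_iff_reachSetoid`).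

So the segment at `c ∉ E_σ` is good iff `c` is not a loop of `G/E_σ`. For `c ∈ E_σ`, removing its
band toggles between one curve and two, so the segment is good iff `c` is not a bridge of `G|E_σ`.
Bridges and loops are what the two Tutte factors detect: they make the terms of the sum cancel in
pairs, and without them a single term has top degree. -/

/-! ### Gluing classes of an equivalence relation -/

namespace Setoid

variable {α : Type*}

/-- The number of classes of `s` that meet `V`. -/
noncomputable def classCount (s : Setoid α) (V : Set α) : ℕ :=
  (Quotient.mk s '' V).ncard

/-- The equivalence relation generated by `s` and one further pair. -/
def glue (s : Setoid α) (x y : α) : Setoid α where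
  r a b := s a b ∨ (s a x ∧ s y b) ∨ (s a y ∧ s x b)
  iseqv :=
    { refl := fun a => Or.inl (s.refl a)
      symm := by
        rintro a b (h | ⟨h, k⟩ | ⟨h, k⟩)
        · exact Or.inl (s.symm h)
        · exact Or.inr (Or.inr ⟨s.symm k, s.symm h⟩)
        · exact Or.inr (Or.inl ⟨s.symm k, s.symm h⟩)
      trans := by
        rintro a b c (h | ⟨h, k⟩ | ⟨h, k⟩) (h' | ⟨h', k'⟩ | ⟨h', k'⟩)
        · exact Or.inl (s.trans h h')
        · exact Or.inr (Or.inl ⟨s.trans h h', k'⟩)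
        · exact Or.inr (Or.inr ⟨s.trans h h', k'⟩)
        · exact Or.inr (Or.inl ⟨h, s.trans k h'⟩)
        · exact Or.inr (Or.inl ⟨h, k'⟩)
        · exact Or.inl (s.trans h k')
        · exact Or.inr (Or.inr ⟨h, s.trans k h'⟩)
        · exact Or.inl (s.trans h k')
        · exact Or.inr (Or.inr ⟨h, k'⟩) }

theorem le_glue (s : Setoid α) (x y : α) : s ≤ s.glue x y := fun _ _ h => Or.inl h

theorem glue_rel (s : Setoid α) (x y : α) : s.glue x y x y :=
  Or.inr (Or.inl ⟨s.refl x, s.refl y⟩)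

theorem glue_le {s t : Setoid α} {x y : α} (h : s ≤ t) (hxy : t x y) : s.glue x y ≤ t := by
  rintro a b (k | ⟨k, l⟩ | ⟨k, l⟩)
  · exact h k
  · exact t.trans (h k) (t.trans hxy (h l))
  · exact t.trans (h k) (t.trans (t.symm hxy) (h l))

theorem glue_eq_self {s : Setoid α} {x y : α} (h : s x y) : s.glue x y = s :=
  le_antisymm (glue_le le_rfl h) (le_glue s x y)

/-- After the class of `y` is dropped, the remaining classes meeting `V` biject with the glued ones,
the class of `x` standing for the merged class. -/
theorem classCount_glue_of_not_rel [Finite α] {s : Setoid α} {x y : α} {V : Set α} (hx : x ∈ V)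
    (hy : y ∈ V) (h : ¬ s x y) : (s.glue x y).classCount V + 1 = s.classCount V := by
  let f : Quotient s → Quotient (s.glue x y) := Quotient.map' id (s.le_glue x y)
  have hf : ∀ a, f (Quotient.mk s a) = Quotient.mk (s.glue x y) a := fun a => rfl
  have himage : f '' (Quotient.mk s '' V \ {Quotient.mk s y}) = Quotient.mk (s.glue x y) '' V := by
    ext q
    constructor
    · rintro ⟨_, ⟨⟨a, ha, rfl⟩, -⟩, rfl⟩
      exact ⟨a, ha, rfl⟩
    · rintro ⟨a, ha, rfl⟩
      by_cases hay : s a y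
      · refine ⟨Quotient.mk s x, ⟨⟨x, hx, rfl⟩, fun e => h (Quotient.exact e)⟩, ?_⟩
        rw [hf]
        exact Quotient.sound (Or.inr (Or.inl ⟨s.refl x, s.symm hay⟩))
      · exact ⟨Quotient.mk s a, ⟨⟨a, ha, rfl⟩, fun e => hay (Quotient.exact e)⟩, rfl⟩
  have hinj : Set.InjOn f (Quotient.mk s '' V \ {Quotient.mk s y}) := by
    rintro _ ⟨⟨a, ha, rfl⟩, hay⟩ _ ⟨⟨b, hb, rfl⟩, hby⟩ e
    rw [hf, hf] at e
    have hay : ¬ s a y := fun k => hay (Quotient.sound k)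
    have hby : ¬ s b y := fun k => hby (Quotient.sound k)
    rcases Quotient.exact e with k | ⟨-, k⟩ | ⟨k, -⟩
    · exact Quotient.sound k
    · exact absurd (s.symm k) hby
    · exact absurd k hay
  have hcard := hinj.ncard_image
  rw [himage] at hcard
  rw [classCount, hcard]
  exact Set.ncard_sdiff_singleton_add_one (Set.mem_image_of_mem _ hy) (Set.toFinite _)

end Setoid

/-! ### Cycles of a permutation composed with a transposition -/

namespace Equiv.Perm

variable {α : Type*}

theorem not_sameCycle_of_return {f : Perm α} {x y : α} {n : ℕ} (hn : 0 < n) (hx : (f ^ n) x = x)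
    (hy : ∀ i < n, (f ^ i) x ≠ y) : ¬ f.SameCycle x y := by
  rintro ⟨i, hi⟩
  have hn' : (n : ℤ) ≠ 0 := by exact_mod_cast hn.ne'
  have hmod : (f ^ (i % n)) x = y := by
    have hper : ∀ k : ℤ, (f ^ ((n : ℤ) * k)) x = x := fun k => by
      rw [zpow_mul, zpow_natCast]
      exact zpow_apply_eq_self_of_apply_eq_self hx k
    rw [← hi]
    conv_rhs => rw [← Int.emod_add_mul_ediv i n, zpow_add, mul_apply, hper]
  obtain ⟨k, hk⟩ := Int.eq_ofNat_of_zero_le (Int.emod_nonneg i hn')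
  have hlt : k < n := by
    have := Int.emod_lt_of_pos i (by exact_mod_cast hn : (0 : ℤ) < n)
    omega
  rw [hk] at hmod
  exact hy k hlt (by simpa using hmod)

/-- Composing with a transposition of two points splits their common cycle, or merges their two
cycles. -/
theorem sameCycle_swap_mul_iff [Finite α] [DecidableEq α] (f : Perm α) {x y : α} (hxy : x ≠ y) :
    (swap x y * f).SameCycle x y ↔ ¬ f.SameCycle x y := by
  -- Take the first positive time at which the orbit of `x` under `f` meets `x` or `y`. Both
  -- permutations agree on `x` before it, and at that time the transposition exchanges the two
  -- outcomes, so exactly one orbit reaches `y`.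
  have hex : ∃ n, 0 < n ∧ ((f ^ n) x = x ∨ (f ^ n) x = y) :=
    ⟨orderOf f, orderOf_pos f, Or.inl (by rw [pow_orderOf_eq_one]; rfl)⟩
  obtain ⟨hn, hret⟩ := Nat.find_spec hex
  have hmin : ∀ i < Nat.find hex, 0 < i → (f ^ i) x ≠ x ∧ (f ^ i) x ≠ y := fun i hi h0 => by
    have := Nat.find_min hex hi
    tauto
  generalize Nat.find hex = n at hn hret hmin
  have hagree : ∀ i < n, ((swap x y * f) ^ i) x = (f ^ i) x := by
    intro i
    induction i with
    | zero => intro _; rfl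
    | succ i ih =>
      intro hi
      obtain ⟨h1, h2⟩ := hmin (i + 1) hi (Nat.succ_pos i)
      rw [pow_succ', mul_apply, ih (by omega), mul_apply, ← mul_apply f, ← pow_succ',
        swap_apply_of_ne_of_ne h1 h2]
  have hlast : ((swap x y * f) ^ n) x = swap x y ((f ^ n) x) := by
    obtain ⟨m, rfl⟩ := Nat.exists_eq_succ_of_ne_zero hn.ne'
    rw [pow_succ', mul_apply, hagree m (by omega), mul_apply, ← mul_apply f, ← pow_succ']
  have havoid : ∀ i < n, (f ^ i) x ≠ y := fun i hi => by
    rcases Nat.eq_zero_or_pos i with rfl | h0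
    · exact hxy
    · exact (hmin i hi h0).2
  rcases hret with h | h
  · rw [h, swap_apply_left] at hlast
    exact iff_of_true ⟨n, by simpa using hlast⟩ (not_sameCycle_of_return hn h havoid)
  · rw [h, swap_apply_right] at hlast
    refine iff_of_false (not_sameCycle_of_return hn hlast fun i hi => ?_)
      (not_not.2 ⟨n, by simpa using h⟩)
    rw [hagree i hi]
    exact havoid i hi

theorem sameCycle_le_of_apply [Finite α] {f : Perm α} {s : Setoid α} (h : ∀ a, s a (f a)) :
    SameCycle.setoid f ≤ s := by
  intro a b hab
  obtain ⟨n, rfl⟩ := SameCycle.exists_nat_pow_eq hab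
  clear hab
  induction n with
  | zero => exact s.refl a
  | succ n ih =>
    rw [pow_succ', mul_apply]
    exact s.trans ih (h _)

theorem sameCycle_swap_mul_le_glue [Finite α] [DecidableEq α] (f : Perm α) (x y : α) :
    SameCycle.setoid (swap x y * f) ≤ (SameCycle.setoid f).glue x y := by
  refine sameCycle_le_of_apply fun a => ?_
  have ha : SameCycle.setoid f a (f a) := sameCycle_apply_right.2 (SameCycle.refl f a)
  rw [mul_apply]
  by_cases h1 : f a = x
  · rw [h1, swap_apply_left]
    exact Or.inr (Or.inl ⟨h1 ▸ ha, (SameCycle.setoid f).refl _⟩)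
  by_cases h2 : f a = y
  · rw [h2, swap_apply_right]
    exact Or.inr (Or.inr ⟨h2 ▸ ha, (SameCycle.setoid f).refl _⟩)
  · rw [swap_apply_of_ne_of_ne h1 h2]
    exact Or.inl ha

/-- Once `x` and `y` are identified the transposition is invisible. One inclusion suffices, since
the transposition is an involution. -/
theorem glue_sameCycle_swap_mul [Finite α] [DecidableEq α] (f : Perm α) (x y : α) :
    (SameCycle.setoid (swap x y * f)).glue x y = (SameCycle.setoid f).glue x y := by
  refine le_antisymm (Setoid.glue_le (sameCycle_swap_mul_le_glue f x y) (Setoid.glue_rel _ _ _))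
    (Setoid.glue_le ?_ (Setoid.glue_rel _ _ _))
  have h := sameCycle_swap_mul_le_glue (swap x y * f) x y
  rwa [← mul_assoc, swap_mul_self, one_mul] at h

/-- The number of cycles, fixed points included. -/
noncomputable def cycleCount (f : Perm α) : ℕ := (SameCycle.setoid f).classCount _root_.Set.univ

theorem cycleCount_swap_mul_of_sameCycle [Finite α] [DecidableEq α] {f : Perm α} {x y : α}
    (hxy : x ≠ y)
    (h : f.SameCycle x y) : (swap x y * f).cycleCount = f.cycleCount + 1 := by
  have h' : ¬ (swap x y * f).SameCycle x y := fun k => (sameCycle_swap_mul_iff f hxy).1 k h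
  have e := Setoid.classCount_glue_of_not_rel (s := SameCycle.setoid (swap x y * f))
    (Set.mem_univ x) (Set.mem_univ y) h'
  rw [glue_sameCycle_swap_mul, Setoid.glue_eq_self (show SameCycle.setoid f x y from h)] at e
  exact e.symm

theorem cycleCount_swap_mul_of_not_sameCycle [Finite α] [DecidableEq α] {f : Perm α} {x y : α}
    (hxy : x ≠ y)
    (h : ¬ f.SameCycle x y) : (swap x y * f).cycleCount + 1 = f.cycleCount := by
  have h' := cycleCount_swap_mul_of_sameCycle hxy ((sameCycle_swap_mul_iff f hxy).2 h)
  rwa [← mul_assoc, swap_mul_self, one_mul, eq_comm] at h'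

end Equiv.Perm

/-! ### Monotone set functions, cancelling sums, leading coefficients -/

namespace Setoid

variable {α : Type*}

theorem classCount_antitone [Finite α] {s t : Setoid α} (h : s ≤ t) (V : Set α) :
    t.classCount V ≤ s.classCount V := by
  have e : Quotient.mk t '' V = Quotient.map' id h '' (Quotient.mk s '' V) := by
    rw [Set.image_image]
    rfl
  rw [classCount, e]
  exact Set.ncard_image_le (Set.toFinite _)

end Setoid

theorem Set.monotone_of_le_insert {ι γ : Type*} [Finite ι] [Preorder γ] {f : Set ι → γ}
    (h : ∀ A e, e ∉ A → f A ≤ f (insert e A)) : Monotone f := by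
  intro A B hAB
  have key : ∀ S : Set ι, S.Finite → Disjoint S A → f A ≤ f (S ∪ A) := by
    intro S hS
    induction S, hS using Set.Finite.induction_on with
    | empty => intro _; rw [Set.empty_union]
    | @insert e S he hS ih =>
      intro hd
      rw [Set.disjoint_insert_left] at hd
      rw [Set.insert_union]
      exact (ih hd.2).trans (h _ _ fun k => k.elim he hd.1)
  have := key (B \ A) (Set.toFinite _) Set.disjoint_sdiff_left
  rwa [Set.sdiff_union_of_subset hAB] at this

/-- Toggling `e` is a fixed-point-free involution of `S` whose pairs cancel. -/
theorem Finset.sum_eq_zero_of_insert {ι R : Type*} [AddCommMonoid R] {S : Finset (Set ι)}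
    {f : Set ι → R} {e : ι} (hS : ∀ A, insert e A ∈ S ↔ A ∈ S)
    (hf : ∀ A ∈ S, e ∉ A → f A + f (insert e A) = 0) : ∑ A ∈ S, f A = 0 := by
  classical
  have hmem : ∀ A ∈ S, A \ {e} ∈ S := fun A hA => by
    rw [← hS, Set.insert_sdiff_singleton, hS]
    exact hA
  refine Finset.sum_involution (fun A _ => if e ∈ A then A \ {e} else insert e A) ?_ ?_ ?_ ?_
  · intro A hA
    split_ifs with h
    · have := hf (A \ {e}) (hmem A hA) (fun k => k.2 rfl)
      rwa [Set.insert_sdiff_singleton, Set.insert_eq_of_mem h, add_comm] at this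
    · exact hf A hA h
  · intro A hA _
    split_ifs with h
    · intro k
      rw [← k] at h
      exact h.2 rfl
    · intro k
      rw [← k] at h
      exact h (Set.mem_insert e A)
  · intro A hA
    split_ifs with h
    · exact hmem A hA
    · exact (hS A).2 hA
  · intro A hA
    by_cases h : e ∈ A
    · simp [h]
    · simp [h]

theorem Polynomial.sum_ne_zero_of_natDegree_lt {ι R : Type*} [Semiring R] {S : Finset ι}
    {f : ι → Polynomial R} {n : ℕ} {i₀ : ι} (h₀ : i₀ ∈ S) (hn : (f i₀).coeff n ≠ 0)
    (h : ∀ i ∈ S, i ≠ i₀ → (f i).natDegree < n) : ∑ i ∈ S, f i ≠ 0 := by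
  intro k
  have e := congrArg (fun p => Polynomial.coeff p n) k
  simp only [Polynomial.finsetSum_coeff, Polynomial.coeff_zero] at e
  rw [Finset.sum_eq_single_of_mem i₀ h₀
    fun i hi hne => Polynomial.coeff_eq_zero_of_natDegree_lt (h i hi hne)] at e
  exact hn e

/-- The evaluation at zero contributes only a sign. -/
theorem Polynomial.natDegree_neg_one_pow_mul_le (m n : ℕ) :
    ((0 - 1 : Polynomial ℤ) ^ m * (Polynomial.X - 1) ^ n).natDegree ≤ n := by
  have e : (0 - 1 : Polynomial ℤ) ^ m = Polynomial.C ((-1) ^ m) := by simp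
  rw [e]
  refine (Polynomial.natDegree_C_mul_le _ _).trans (Polynomial.natDegree_pow_le.trans ?_)
  have : (Polynomial.X - 1 : Polynomial ℤ).natDegree = 1 := Polynomial.natDegree_X_sub_C 1
  rw [this, mul_one]

theorem Polynomial.coeff_X_sub_one_pow_self (n : ℕ) :
    ((Polynomial.X - 1 : Polynomial ℤ) ^ n).coeff n = 1 := by
  have h := Polynomial.monic_X_sub_C (1 : ℤ)
  have := h.pow n
  rwa [Polynomial.Monic, Polynomial.leadingCoeff, h.natDegree_pow, Polynomial.natDegree_X_sub_C,
    mul_one, Polynomial.C_1] at this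

/-! ### Bridges, loops and the vanishing of the Tutte polynomial -/

namespace Graph

variable {α β : Type*} (G : Graph α β)

theorem numComponents_restrict (A : Set β) :
    (G.restrict A).numComponents = (G.restrict A).reachSetoid.classCount G.vertexSet := rfl

variable {G} in
theorem reachSetoid_restrict_mono {A B : Set β} (h : A ⊆ B) :
    (G.restrict A).reachSetoid ≤ (G.restrict B).reachSetoid := by
  refine Setoid.eqvGen_le ?_
  rintro x y ⟨e, he⟩
  rw [restrict_isLink] at he
  exact Relation.EqvGen.rel _ _ ⟨e, by rw [restrict_isLink]; exact ⟨h he.1, he.2⟩⟩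

variable {G} in
theorem IsLink.reachSetoid_restrict {e : β} {x y : α} (h : G.IsLink e x y) {A : Set β}
    (he : e ∈ A) : (G.restrict A).reachSetoid x y :=
  Relation.EqvGen.rel _ _ ⟨e, by rw [restrict_isLink]; exact ⟨he, h⟩⟩

variable {G} in
theorem IsLink.reachSetoid_restrict_insert {e : β} {x y : α} (h : G.IsLink e x y) (A : Set β) :
    (G.restrict (insert e A)).reachSetoid = (G.restrict A).reachSetoid.glue x y := by
  refine le_antisymm (Setoid.eqvGen_le ?_) (Setoid.glue_le
    (reachSetoid_restrict_mono (Set.subset_insert e A))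
    (h.reachSetoid_restrict (Set.mem_insert e A)))
  rintro a b ⟨f, hf⟩
  rw [restrict_isLink] at hf
  obtain ⟨rfl | hA, hf⟩ := hf
  · rcases hf.eq_and_eq_or_eq_and_eq h with ⟨rfl, rfl⟩ | ⟨rfl, rfl⟩
    · exact Setoid.glue_rel _ _ _
    · exact Setoid.symm' _ (Setoid.glue_rel _ _ _)
  · exact Or.inl (hf.reachSetoid_restrict hA)

theorem reachSetoid_restrict_empty {x y : α} : (G.restrict ∅).reachSetoid x y ↔ x = y := by
  constructor
  · intro h
    have : (G.restrict ∅).reachSetoid ≤ ⊥ := by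
      refine Setoid.eqvGen_le ?_
      rintro a b ⟨f, hf⟩
      rw [restrict_isLink] at hf
      exact absurd hf.1 (Set.notMem_empty f)
    exact this h
  · rintro rfl
    exact Setoid.refl' _ _

theorem numComponents_restrict_empty : (G.restrict ∅).numComponents = G.vertexSet.ncard := by
  rw [numComponents_restrict, Setoid.classCount]
  exact Set.ncard_image_of_injective _ fun x y h =>
    (G.reachSetoid_restrict_empty).1 (Quotient.exact h)

variable {G} in
theorem IsLink.numComponents_insert_of_reach {e : β} {x y : α} (h : G.IsLink e x y) {A : Set β}
    (hA : (G.restrict A).reachSetoid x y) :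
    (G.restrict (insert e A)).numComponents = (G.restrict A).numComponents := by
  rw [numComponents_restrict, h.reachSetoid_restrict_insert, Setoid.glue_eq_self hA]
  rfl

theorem contractEdges_isLink {H : Set β} {e : β} {p q : Quotient (G.restrict H).reachSetoid} :
    (G.contractEdges H).IsLink e p q ↔
      e ∉ H ∧ ∃ x y, G.IsLink e x y ∧ Quotient.mk _ x = p ∧ Quotient.mk _ y = q := by
  rw [contractEdges, deleteEdges_isLink, map_isLink, and_comm]
  rfl

theorem aeval_tutte [Finite β] (a b : Polynomial ℤ) :
    MvPolynomial.aeval ![a, b] G.tutte =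
      ∑ A ∈ (Set.toFinite {A : Set β | A ⊆ G.edgeSet}).toFinset,
        (a - 1) ^ ((G.restrict A).numComponents - G.numComponents) *
          (b - 1) ^ (A.ncard + (G.restrict A).numComponents - G.vertexSet.ncard) := by
  rw [tutte, finsum_mem_eq_finite_toFinset_sum _ (Set.toFinite _), map_sum]
  simp

variable [Finite α]

theorem numComponents_restrict_antitone {A B : Set β} (h : A ⊆ B) :
    (G.restrict B).numComponents ≤ (G.restrict A).numComponents :=
  Setoid.classCount_antitone (reachSetoid_restrict_mono h) _

variable {G} in
theorem IsLink.numComponents_insert_of_not_reach {e : β} {x y : α} (h : G.IsLink e x y)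
    {A : Set β} (hA : ¬ (G.restrict A).reachSetoid x y) :
    (G.restrict (insert e A)).numComponents + 1 = (G.restrict A).numComponents := by
  rw [numComponents_restrict, h.reachSetoid_restrict_insert,
    Setoid.classCount_glue_of_not_rel h.left_mem h.right_mem hA]
  rfl

theorem numComponents_restrict_le_insert_add_one (e : β) (A : Set β) :
    (G.restrict A).numComponents ≤ (G.restrict (insert e A)).numComponents + 1 := by
  by_cases he : e ∈ G.edgeSet
  · obtain ⟨x, y, h⟩ := exists_isLink_of_mem_edgeSet he
    by_cases hA : (G.restrict A).reachSetoid x y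
    · rw [h.numComponents_insert_of_reach hA]
      omega
    · exact (h.numComponents_insert_of_not_reach hA).ge
  · rw [← restrict_inter_edgeSet G (insert e A), Set.insert_inter_of_notMem he,
      restrict_inter_edgeSet]
    omega

variable [Finite β]

/-- Up to the constant `|V|` this is the nullity: a new edge adds one to `|A|` and removes at most
one component. -/
theorem monotone_ncard_add_numComponents :
    Monotone fun A : Set β => A.ncard + (G.restrict A).numComponents := by
  refine Set.monotone_of_le_insert fun A e he => ?_
  have := G.numComponents_restrict_le_insert_add_one e A
  simp only [Set.ncard_insert_of_notMem he]
  omega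

theorem vertexSet_ncard_le (A : Set β) :
    G.vertexSet.ncard ≤ A.ncard + (G.restrict A).numComponents := by
  have := G.monotone_ncard_add_numComponents (Set.empty_subset A)
  simp only at this
  rwa [Set.ncard_empty, zero_add, numComponents_restrict_empty] at this

/-- The Tutte polynomial of a finite graph vanishes at `x = 0` if and only if the graph has a
bridge. -/
theorem aeval_zero_X_tutte_ne_zero_iff :
    MvPolynomial.aeval ![0, Polynomial.X] G.tutte ≠ (0 : Polynomial ℤ) ↔
      ∀ e x y, G.IsLink e x y → (G.restrict (G.edgeSet \ {e})).reachSetoid x y := by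
  rw [aeval_tutte]
  constructor
  · contrapose!
    rintro ⟨e, x, y, h, hbr⟩
    -- Adding the bridge `e` to `A` lowers the number of components by one and keeps the nullity, so
    -- paired terms differ by the factor `0 - 1`.
    refine Finset.sum_eq_zero_of_insert (e := e) ?_ ?_
    · intro A
      simp [Set.insert_subset_iff, h.edge_mem]
    · intro A hA he
      rw [Set.Finite.mem_toFinset, Set.mem_ofPred_eq] at hA
      have hk := h.numComponents_insert_of_not_reach (A := A) fun k =>
        hbr (reachSetoid_restrict_mono (Set.subset_sdiff_singleton hA he) k)
      have hE := G.numComponents_restrict_antitone (Set.insert_subset h.edge_mem hA)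
      rw [restrict_self] at hE
      have e1 : (G.restrict A).numComponents - G.numComponents =
          (G.restrict (insert e A)).numComponents - G.numComponents + 1 := by omega
      have e2 : (insert e A).ncard + (G.restrict (insert e A)).numComponents =
          A.ncard + (G.restrict A).numComponents := by
        rw [Set.ncard_insert_of_notMem he]
        omega
      rw [e1, e2]
      ring
  · intro h
    -- Only the full edge set has maximal nullity: a proper subset misses some edge `e`, and
    -- deleting the non-bridge `e` already lowers the nullity by one.
    refine Polynomial.sum_ne_zero_of_natDegree_lt (i₀ := G.edgeSet)
      (n := G.edgeSet.ncard + G.numComponents - G.vertexSet.ncard) (by simp) ?_ ?_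
    · rw [restrict_self, Nat.sub_self, pow_zero, one_mul, Polynomial.coeff_X_sub_one_pow_self]
      exact one_ne_zero
    · intro A hA hne
      rw [Set.Finite.mem_toFinset, Set.mem_ofPred_eq] at hA
      refine (Polynomial.natDegree_neg_one_pow_mul_le _ _).trans_lt ?_
      obtain ⟨e, he, heA⟩ := Set.exists_of_ssubset (hA.ssubset_of_ne hne)
      obtain ⟨x, y, hl⟩ := exists_isLink_of_mem_edgeSet he
      have h1 := G.monotone_ncard_add_numComponents (Set.subset_sdiff_singleton hA heA)
      have h2 := hl.numComponents_insert_of_reach (h e x y hl)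
      rw [Set.insert_sdiff_singleton, Set.insert_eq_of_mem he, restrict_self] at h2
      have h3 := Set.ncard_sdiff_singleton_add_one he (Set.toFinite _)
      have h4 := G.vertexSet_ncard_le A
      simp only at h1
      omega

/-- The Tutte polynomial of a finite graph vanishes at `y = 0` if and only if the graph has a
loop. -/
theorem aeval_X_zero_tutte_ne_zero_iff :
    MvPolynomial.aeval ![Polynomial.X, 0] G.tutte ≠ (0 : Polynomial ℤ) ↔
      ∀ e x, ¬ G.IsLink e x x := by
  rw [aeval_tutte]
  constructor
  · contrapose!
    rintro ⟨e, x, h⟩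
    -- Adding the loop `e` keeps the components and raises the nullity by one, so paired terms
    -- differ by the factor `0 - 1`.
    refine Finset.sum_eq_zero_of_insert (e := e) ?_ ?_
    · intro A
      simp [Set.insert_subset_iff, h.edge_mem]
    · intro A hA he
      rw [Set.Finite.mem_toFinset, Set.mem_ofPred_eq] at hA
      have hk := h.numComponents_insert_of_reach (A := A) (Setoid.refl' _ _)
      have hV := G.vertexSet_ncard_le A
      have e2 : (insert e A).ncard + (G.restrict (insert e A)).numComponents - G.vertexSet.ncard =
          A.ncard + (G.restrict A).numComponents - G.vertexSet.ncard + 1 := by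
        rw [Set.ncard_insert_of_notMem he]
        omega
      rw [e2, hk]
      ring
  · intro h
    -- Only the empty set has the maximal number of components, since any edge that is not a loop
    -- joins two vertices.
    refine Polynomial.sum_ne_zero_of_natDegree_lt (i₀ := ∅)
      (n := (G.restrict ∅).numComponents - G.numComponents) (by simp) ?_ ?_
    · rw [Set.ncard_empty, zero_add, ← numComponents_restrict_empty, Nat.sub_self, pow_zero,
        mul_one, Polynomial.coeff_X_sub_one_pow_self]
      exact one_ne_zero
    · intro A hA hne
      rw [Set.Finite.mem_toFinset, Set.mem_ofPred_eq] at hA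
      rw [mul_comm]
      refine (Polynomial.natDegree_neg_one_pow_mul_le _ _).trans_lt ?_
      obtain ⟨e, he⟩ := Set.nonempty_iff_ne_empty.2 hne
      obtain ⟨x, y, hl⟩ := exists_isLink_of_mem_edgeSet (hA he)
      have h1 := hl.numComponents_insert_of_not_reach (A := ∅) fun k => by
        obtain rfl := G.reachSetoid_restrict_empty.1 k
        exact h e x hl
      have h2 := G.numComponents_restrict_antitone
        (Set.insert_subset he (Set.empty_subset A))
      have h3 := G.numComponents_restrict_antitone hA
      rw [restrict_self] at h3
      omega

end Graph

/-! ### Diagram codes, colors and the boundary of the black surface -/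

theorem ZMod.four_eq_of_add_neg_one {i j : ZMod 4} (h : j + -1 = i ∨ j + -1 = i + 2) :
    j = i + 1 ∨ j = i + 3 := by
  revert i j
  decide

namespace DiagramCode

variable {C : Type*} (D : DiagramCode C)

instance [Finite C] : Finite D.Region := inferInstanceAs (Finite (Quotient _))

instance [Finite C] : Finite D.Arc := inferInstanceAs (Finite (Quotient _))

instance [Finite C] : Finite D.Component := inferInstanceAs (Finite (Quotient _))

instance [Nonempty C] : Nonempty D.Component := ‹Nonempty C›.map (Quotient.mk _)

theorem region_rot_inv_arc (d : Dart C) : D.region ((rot C)⁻¹ (D.arc d)) = D.region d :=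
  Quotient.sound (Equiv.Perm.sameCycle_apply_left.2 (Equiv.Perm.SameCycle.refl _ d))

theorem eq_or_eq_arc_of_sameCycle [Finite C] {d d' : Dart C} (h : D.arc.SameCycle d d') :
    d' = d ∨ d' = D.arc d := by
  obtain ⟨n, rfl⟩ := h.exists_nat_pow_eq
  clear h
  induction n with
  | zero => exact Or.inl rfl
  | succ n ih =>
    rw [pow_succ', Equiv.Perm.mul_apply]
    rcases ih with ih | ih <;> rw [ih]
    · exact Or.inr rfl
    · exact Or.inl (D.arc_arc d)

end DiagramCode

namespace LinkDiagram

variable {C : Type*} {D : LinkDiagram C}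

namespace Checkerboard

variable (κ : D.Checkerboard)

/-- The corner `d` is black; equivalently, the edge that leaves through `d` has a black region on
its left. -/
def IsBlack (d : Dart C) : Prop := κ.shade (D.region d) = .black

theorem isBlack_rot (d : Dart C) : κ.IsBlack (rot C d) ↔ ¬ κ.IsBlack d := by
  have h := κ.shade_ne d
  unfold IsBlack
  cases h1 : κ.shade (D.region d) <;> cases h2 : κ.shade (D.region (rot C d)) <;> simp_all

theorem isBlack_rot_inv (d : Dart C) : κ.IsBlack ((rot C)⁻¹ d) ↔ ¬ κ.IsBlack d := by
  have h := κ.isBlack_rot ((rot C)⁻¹ d)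
  rw [show rot C ((rot C)⁻¹ d) = d from (rot C).apply_symm_apply d] at h
  tauto

/-- The two sides of an edge have different colors: the corners at `arc d` on either side of that
end are adjacent, and one of them lies in the region of `d`. -/
theorem isBlack_arc (d : Dart C) : κ.IsBlack (D.arc d) ↔ ¬ κ.IsBlack d := by
  have h := κ.isBlack_rot_inv (D.arc d)
  have e : κ.IsBlack ((rot C)⁻¹ (D.arc d)) ↔ κ.IsBlack d := by
    unfold IsBlack
    rw [D.region_rot_inv_arc]
  tauto

theorem eq_of_isBlack_of_not_isBlack {c : C} {i j : ZMod 4} (hi : κ.IsBlack (c, i))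
    (hj : ¬ κ.IsBlack (c, j)) : j = i + 1 ∨ j = i + 3 :=
  ZMod.four_eq_of_add_neg_one (κ.black_unique c hi ((κ.isBlack_rot_inv (c, j)).2 hj))

/-- The darts with a black region on their left. -/
abbrev BlackDart : Type _ := {d : Dart C // κ.IsBlack d}

/-- The turn taken at the end of an edge by the boundary of the black surface whose bands are the
crossings in `A`. -/
noncomputable def turn (A : Set C) (d : Dart C) : Dart C :=
  open Classical in if d.1 ∈ A then rot C d else (rot C)⁻¹ d

theorem turn_of_mem {A : Set C} {d : Dart C} (h : d.1 ∈ A) : turn A d = rot C d := if_pos h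

theorem turn_of_notMem {A : Set C} {d : Dart C} (h : d.1 ∉ A) : turn A d = (rot C)⁻¹ d := if_neg h

theorem turn_fst (A : Set C) (d : Dart C) : (turn A d).1 = d.1 := by
  unfold turn
  split_ifs <;> rfl

theorem turn_injective (A : Set C) : Function.Injective (turn A) := by
  intro d d' h
  have e : d.1 = d'.1 := by rw [← turn_fst A d, h, turn_fst]
  by_cases hd : d.1 ∈ A
  · rw [turn_of_mem hd, turn_of_mem (e ▸ hd)] at h
    exact (rot C).injective h
  · rw [turn_of_notMem hd, turn_of_notMem (e ▸ hd)] at h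
    exact (rot C)⁻¹.injective h

theorem isBlack_turn (A : Set C) (d : Dart C) : κ.IsBlack (turn A d) ↔ ¬ κ.IsBlack d := by
  unfold turn
  split_ifs
  · exact κ.isBlack_rot d
  · exact κ.isBlack_rot_inv d

/-- One step along the boundary of the black surface with bands `A`. -/
noncomputable def walkStep (A : Set C) (b : κ.BlackDart) : κ.BlackDart :=
  ⟨turn A (D.arc b.1), by
    rw [isBlack_turn, isBlack_arc, not_not]
    exact b.2⟩

theorem isLink_tait {c : C} {i : ZMod 4} (hi : κ.IsBlack (c, i)) (hi' : κ.IsBlack (c, i + 2)) :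
    κ.tait.IsLink c (D.region (c, i)) (D.region (c, i + 2)) :=
  ⟨i, rfl, rfl, hi, hi'⟩

theorem reachSetoid_region {A : Set C} {c : C} (hc : c ∈ A) {i j : ZMod 4}
    (hi : κ.IsBlack (c, i)) (hj : κ.IsBlack (c, j)) :
    (κ.tait.restrict A).reachSetoid (D.region (c, i)) (D.region (c, j)) := by
  rcases κ.black_unique c hi hj with rfl | rfl
  · exact Setoid.refl' _ _
  · exact (κ.isLink_tait hi hj).reachSetoid_restrict hc

variable [Finite C]

/-- The boundary of the black surface consisting of the black regions and a band at each crossing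
in `A`, as a permutation of the edges directed with black on the left. -/
noncomputable def walk (A : Set C) : Equiv.Perm κ.BlackDart :=
  Equiv.ofBijective (κ.walkStep A) <| Finite.injective_iff_bijective.1 fun _ _ h =>
    Subtype.ext (D.arc.injective (turn_injective A (congrArg Subtype.val h)))

theorem walk_apply_val (A : Set C) (b : κ.BlackDart) :
    (κ.walk A b).1 = turn A (D.arc b.1) := rfl

/-- Only arrivals at `c` are affected. Such an arrival is at a white end, whose two neighbors are
the black ends of `c`; the band replaces one neighbor by the other. -/
theorem walk_insert [DecidableEq κ.BlackDart] {A : Set C} {c : C} (hc : c ∉ A) {i : ZMod 4}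
    (hi : κ.IsBlack (c, i)) (hi' : κ.IsBlack (c, i + 2)) :
    κ.walk (insert c A) =
      Equiv.swap (⟨(c, i), hi⟩ : κ.BlackDart) ⟨(c, i + 2), hi'⟩ * κ.walk A := by
  have swap_eq : ∀ b b' : κ.BlackDart, (b.1 = (c, i) ∧ b'.1 = (c, i + 2)) ∨
      (b.1 = (c, i + 2) ∧ b'.1 = (c, i)) →
      b' = Equiv.swap (⟨(c, i), hi⟩ : κ.BlackDart) ⟨(c, i + 2), hi'⟩ b := by
    rintro ⟨b, hb⟩ ⟨b', hb'⟩ (⟨h, h'⟩ | ⟨h, h'⟩)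
    · have h : b = _ := h
      have h' : b' = _ := h'
      subst h h'
      exact (Equiv.swap_apply_left _ _).symm
    · have h : b = _ := h
      have h' : b' = _ := h'
      subst h h'
      exact (Equiv.swap_apply_right _ _).symm
  refine Equiv.ext fun b => ?_
  rw [Equiv.Perm.mul_apply]
  by_cases hb : (D.arc b.1).1 = c
  · refine swap_eq _ _ ?_
    rw [walk_apply_val, walk_apply_val, turn_of_mem (Set.mem_insert_iff.2 (Or.inl hb)),
      turn_of_notMem (hb ▸ hc)]
    have hw : ¬ κ.IsBlack (D.arc b.1) := fun k => (κ.isBlack_arc b.1).1 k b.2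
    generalize D.arc b.1 = w at hb hw
    obtain ⟨_, j⟩ := w
    obtain rfl : _ = c := hb
    have e1 : i + 1 + 1 = i + 2 := by ring
    have e2 : i + 1 + -1 = i := by ring
    have e3 : i + 3 + 1 = i := by rw [add_assoc, show (3 : ZMod 4) + 1 = 0 by decide, add_zero]
    have e4 : i + 3 + -1 = i + 2 := by ring
    rcases κ.eq_of_isBlack_of_not_isBlack hi hw with rfl | rfl
    · exact Or.inl ⟨congrArg (Prod.mk _) e2, congrArg (Prod.mk _) e1⟩
    · exact Or.inr ⟨congrArg (Prod.mk _) e4, congrArg (Prod.mk _) e3⟩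
  · have hne : ∀ k (hk : κ.IsBlack (c, k)), κ.walk A b ≠ ⟨(c, k), hk⟩ := fun k hk h => by
      refine hb ?_
      rw [← turn_fst A, ← walk_apply_val, h]
    rw [Equiv.swap_apply_of_ne_of_ne (hne _ _) (hne _ _)]
    refine Subtype.ext ?_
    rw [walk_apply_val, walk_apply_val]
    by_cases hA : (D.arc b.1).1 ∈ A
    · rw [turn_of_mem hA, turn_of_mem (Set.mem_insert_of_mem c hA)]
    · rw [turn_of_notMem hA, turn_of_notMem fun k => k.elim hb hA]

/-- A boundary curve stays in one component: each step keeps the black region or passes to the one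
across a band of `A`. -/
theorem reachSetoid_of_sameCycle_walk {A : Set C} {b b' : κ.BlackDart}
    (h : (κ.walk A).SameCycle b b') :
    (κ.tait.restrict A).reachSetoid (D.region b.1) (D.region b'.1) := by
  have key : Equiv.Perm.SameCycle.setoid (κ.walk A) ≤
      (κ.tait.restrict A).reachSetoid.comap fun b : κ.BlackDart => D.region b.1 := by
    refine Equiv.Perm.sameCycle_le_of_apply fun b => ?_
    change (κ.tait.restrict A).reachSetoid (D.region b.1) (D.region (turn A (D.arc b.1)))
    rw [← D.region_rot_inv_arc b.1]
    have hw : ¬ κ.IsBlack (D.arc b.1) := fun k => (κ.isBlack_arc b.1).1 k b.2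
    by_cases hA : (D.arc b.1).1 ∈ A
    · rw [turn_of_mem hA]
      exact κ.reachSetoid_region hA ((κ.isBlack_rot_inv _).2 hw) ((κ.isBlack_rot _).2 hw)
    · rw [turn_of_notMem hA]
  exact key h

/-! ### Genus of the black surface -/

theorem cycleCount_walk_empty_le : (κ.walk ∅).cycleCount ≤ κ.tait.vertexSet.ncard := by
  -- Without bands the walk is the permutation defining regions, restricted to black corners.
  have hpow : ∀ (n : ℕ) (b : κ.BlackDart),
      ((κ.walk ∅ ^ n) b).1 = (((rot C)⁻¹ * D.arc) ^ n) b.1 := by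
    intro n b
    induction n with
    | zero => rfl
    | succ n ih =>
      rw [pow_succ', Equiv.Perm.mul_apply, walk_apply_val, ih,
        turn_of_notMem (Set.notMem_empty _), pow_succ']
      rfl
  have hstep : ∀ b b' : κ.BlackDart, D.region b.1 = D.region b'.1 ↔ (κ.walk ∅).SameCycle b b' := by
    intro b b'
    constructor
    · intro h
      obtain ⟨n, hn⟩ := Equiv.Perm.SameCycle.exists_nat_pow_eq (Quotient.exact h)
      exact ⟨n, Subtype.ext (by rw [zpow_natCast, hpow, hn])⟩
    · intro h
      obtain ⟨n, rfl⟩ := h.exists_nat_pow_eq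
      rw [hpow]
      exact Quotient.sound ⟨n, rfl⟩
  let f : Quotient (Equiv.Perm.SameCycle.setoid (κ.walk ∅)) → D.Region :=
    Quotient.lift (fun b => D.region b.1) fun b b' h => (hstep b b').2 h
  refine Set.ncard_le_ncard_of_injOn f ?_ ?_ (Set.toFinite _)
  · rintro _ ⟨b, -, rfl⟩
    exact b.2
  · rintro _ ⟨b, -, rfl⟩ _ ⟨b', -, rfl⟩ h
    exact Quotient.sound ((hstep b b').1 h)

/-- With all bands attached, each boundary curve keeps one white region on its right, and every
white region occurs this way. -/
theorem ncard_compl_vertexSet_tait_le :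
    (κ.tait.vertexSetᶜ).ncard ≤ (κ.walk Set.univ).cycleCount := by
  have hle : Equiv.Perm.SameCycle.setoid (κ.walk Set.univ) ≤
      Setoid.ker fun b : κ.BlackDart => D.region (D.arc b.1) := by
    refine Equiv.Perm.sameCycle_le_of_apply fun b => ?_
    change D.region (D.arc b.1) = D.region (D.arc (turn Set.univ (D.arc b.1)))
    rw [← D.region_rot_inv_arc (D.arc (turn Set.univ (D.arc b.1))), D.arc_arc,
      turn_of_mem (Set.mem_univ _)]
    exact congrArg D.region ((rot C).symm_apply_apply _).symm
  let f : Quotient (Equiv.Perm.SameCycle.setoid (κ.walk Set.univ)) → D.Region :=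
    Quotient.lift (fun b => D.region (D.arc b.1)) fun _ _ h => hle h
  refine (Set.ncard_le_ncard ?_ (Set.toFinite _)).trans
    (Set.ncard_image_le (f := f) (Set.toFinite _))
  intro r hr
  induction r using Quotient.inductionOn with
  | h d =>
    have hd : ¬ κ.IsBlack d := hr
    refine ⟨_, ⟨⟨D.arc d, (κ.isBlack_arc d).2 hd⟩, Set.mem_univ _, rfl⟩, ?_⟩
    change D.region (D.arc (D.arc d)) = D.region d
    rw [D.arc_arc]

/-- Each crossing has two black ends, and no edge has both of its ends black. -/
theorem two_mul_card_le_card_arc (κ : D.Checkerboard) : 2 * Nat.card C ≤ Nat.card D.Arc := by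
  choose i hi hi' using κ.exists_black
  let b : C × Bool → Dart C := fun p => (p.1, if p.2 then i p.1 + 2 else i p.1)
  have hb : ∀ p, κ.IsBlack (b p) := by
    rintro ⟨c, _ | _⟩
    · exact hi c
    · exact hi' c
  have hinj : Function.Injective fun p => (Quotient.mk _ (b p) : D.Arc) := by
    intro p q h
    rcases D.eq_or_eq_arc_of_sameCycle (Quotient.exact h) with k | k
    · obtain ⟨c, s⟩ := p
      obtain ⟨c', s'⟩ := q
      obtain rfl : c' = c := congrArg Prod.fst k
      have k2 : (if s' then i c' + 2 else i c') = if s then i c' + 2 else i c' :=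
        congrArg Prod.snd k
      have hne : i c' + 2 ≠ i c' := by
        generalize i c' = j
        revert j
        decide
      cases s <;> cases s' <;> simp_all
    · exact absurd (k ▸ hb q) fun m => (κ.isBlack_arc (b p)).1 m (hb p)
  have : Nat.card (C × Bool) ≤ Nat.card D.Arc := Nat.card_le_card_of_injective _ hinj
  rw [Nat.card_prod, Nat.card_eq_fintype_card (α := Bool), Fintype.card_bool] at this
  omega

/-- The black region beside an edge of the projection graph has corners at both its end crossings,
so a path of crossings gives a path of black regions. -/
theorem numComponents_tait_le_one (hD : D.Connected) :
    (κ.tait.restrict Set.univ).numComponents ≤ 1 := by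
  choose i hi hi' using κ.exists_black
  have key : D.componentSetoid ≤
      (κ.tait.restrict Set.univ).reachSetoid.comap fun c => D.region (c, i c) := by
    refine Setoid.eqvGen_le ?_
    rintro c c' ⟨j, j', h⟩
    have hstep : ∀ {d d' : Dart C}, D.arc d = d' → κ.IsBlack d →
        (κ.tait.restrict Set.univ).reachSetoid (D.region (d.1, i d.1))
          (D.region (d'.1, i d'.1)) := by
      rintro d _ rfl hd
      have hw : ¬ κ.IsBlack (D.arc d) := fun k => (κ.isBlack_arc d).1 k hd
      refine Setoid.trans' _ (κ.reachSetoid_region (Set.mem_univ _) (hi d.1) hd) ?_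
      change (κ.tait.restrict Set.univ).reachSetoid (D.region d) _
      rw [← D.region_rot_inv_arc d]
      exact κ.reachSetoid_region (Set.mem_univ _) ((κ.isBlack_rot_inv _).2 hw) (hi _)
    by_cases hj : κ.IsBlack (c, j)
    · exact hstep h hj
    · refine Setoid.symm' _ (hstep (d := (c', j')) (d' := (c, j)) ?_ ?_)
      · rw [← h, D.arc_arc]
      · rw [← h]
        exact (κ.isBlack_arc _).2 hj
  rw [Graph.numComponents_restrict, Setoid.classCount, Set.ncard_le_one_iff]
  rintro _ _ ⟨r, hr, rfl⟩ ⟨s, hs, rfl⟩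
  induction r using Quotient.inductionOn with
  | h d =>
  induction s using Quotient.inductionOn with
  | h d' =>
    refine Quotient.sound ?_
    exact Setoid.trans' _ (κ.reachSetoid_region (Set.mem_univ d.1) hr (hi d.1))
      (Setoid.trans' _ (key (hD d.1 d'.1)) (κ.reachSetoid_region (Set.mem_univ d'.1) (hi d'.1) hs))

/-- Up to an additive constant, twice the genus of the black surface with bands `A`. -/
noncomputable def excess (A : Set C) : ℤ :=
  2 * (κ.tait.restrict A).numComponents + A.ncard - (κ.walk A).cycleCount

/-- The band may split a curve, merge curves of two components, or merge two curves of one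
component. The changes of `excess` are 0, 0 and 2; equality rules out the last case, the only one in
which the equivalence fails. -/
theorem excess_insert {A : Set C} {c : C} (hc : c ∉ A) {i : ZMod 4}
    (hi : κ.IsBlack (c, i)) (hi' : κ.IsBlack (c, i + 2)) :
    κ.excess A ≤ κ.excess (insert c A) ∧ (κ.excess A = κ.excess (insert c A) →
      ((κ.walk A).SameCycle ⟨(c, i), hi⟩ ⟨(c, i + 2), hi'⟩ ↔
        (κ.tait.restrict A).reachSetoid (D.region (c, i)) (D.region (c, i + 2)))) := by
  classical
  have hne : (⟨(c, i), hi⟩ : κ.BlackDart) ≠ ⟨(c, i + 2), hi'⟩ := by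
    intro h
    have h2 : i = i + 2 := congrArg (fun b : κ.BlackDart => b.1.2) h
    clear hi hi' h
    revert i
    decide
  have hl := κ.isLink_tait hi hi'
  unfold excess
  rw [Set.ncard_insert_of_notMem hc]
  by_cases h : (κ.walk A).SameCycle ⟨(c, i), hi⟩ ⟨(c, i + 2), hi'⟩
  · have hr := κ.reachSetoid_of_sameCycle_walk h
    have h1 := Equiv.Perm.cycleCount_swap_mul_of_sameCycle hne h
    rw [← κ.walk_insert hc] at h1
    have h2 := hl.numComponents_insert_of_reach hr
    exact ⟨by omega, fun _ => iff_of_true h hr⟩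
  · have h1 := Equiv.Perm.cycleCount_swap_mul_of_not_sameCycle hne h
    rw [← κ.walk_insert hc] at h1
    by_cases hr : (κ.tait.restrict A).reachSetoid (D.region (c, i)) (D.region (c, i + 2))
    · have h2 := hl.numComponents_insert_of_reach hr
      exact ⟨by omega, fun k => by omega⟩
    · have h2 := hl.numComponents_insert_of_not_reach hr
      exact ⟨by omega, fun _ => iff_of_false h hr⟩

theorem monotone_excess : Monotone κ.excess := by
  refine Set.monotone_of_le_insert fun A c hc => ?_
  obtain ⟨i, hi, hi'⟩ := κ.exists_black c
  exact (κ.excess_insert hc hi hi').1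

/-- The number of black regions separates the two values: it bounds `excess ∅` from below, as there
are at most that many curves, and `excess univ` from above, as Euler's formula gives enough white
regions. -/
theorem excess_univ_le_excess_empty [Nonempty C] (hD : D.Connected) :
    κ.excess Set.univ ≤ κ.excess ∅ := by
  have h1 := κ.cycleCount_walk_empty_le
  have h2 := κ.ncard_compl_vertexSet_tait_le
  have h3 := κ.two_mul_card_le_card_arc
  have h4 := κ.numComponents_tait_le_one hD
  have h5 := D.planar
  have h6 : 0 < Nat.card D.Component := Nat.card_pos
  have h7 := Set.ncard_add_ncard_compl κ.tait.vertexSet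
  unfold excess
  rw [Graph.numComponents_restrict_empty, Set.ncard_empty, Set.ncard_univ]
  omega

/-- In a planar diagram, two black corners at a crossing outside `A` lie on the same boundary curve
of the black surface with bands `A` if and only if they lie in the same component of it. -/
theorem sameCycle_walk_iff_reachSetoid [Nonempty C] (hD : D.Connected) {A : Set C} {c : C}
    (hc : c ∉ A) {i : ZMod 4} (hi : κ.IsBlack (c, i)) (hi' : κ.IsBlack (c, i + 2)) :
    (κ.walk A).SameCycle ⟨(c, i), hi⟩ ⟨(c, i + 2), hi'⟩ ↔
      (κ.tait.restrict A).reachSetoid (D.region (c, i)) (D.region (c, i + 2)) := by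
  obtain ⟨h1, h2⟩ := κ.excess_insert hc hi hi'
  -- The excess is squeezed along `insert c A ⊆ univ`, the Euler bound, and `∅ ⊆ A`.
  refine h2 (h1.antisymm ?_)
  exact (κ.monotone_excess (Set.subset_univ _)).trans
    ((κ.excess_univ_le_excess_empty hD).trans (κ.monotone_excess (Set.empty_subset A)))

theorem sameCycle_walk_insert_iff [Nonempty C] (hD : D.Connected) {A : Set C} {c : C}
    (hc : c ∉ A) {i : ZMod 4} (hi : κ.IsBlack (c, i)) (hi' : κ.IsBlack (c, i + 2)) :
    (κ.walk (insert c A)).SameCycle ⟨(c, i), hi⟩ ⟨(c, i + 2), hi'⟩ ↔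
      ¬ (κ.tait.restrict A).reachSetoid (D.region (c, i)) (D.region (c, i + 2)) := by
  classical
  rw [← κ.sameCycle_walk_iff_reachSetoid hD hc hi hi', κ.walk_insert hc hi hi',
    Equiv.Perm.sameCycle_swap_mul_iff]
  intro h
  have h2 : i = i + 2 := congrArg (fun b : κ.BlackDart => b.1.2) h
  clear hi hi' h
  revert i
  decide

end Checkerboard

end LinkDiagram

/-! ### State circles as boundary curves -/

namespace LinkDiagram

variable {C : Type*} {D : LinkDiagram C}

theorem circleSetoid_arc (σ : D.State) (d : Dart C) : D.circleSetoid σ d (D.arc d) :=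
  Relation.EqvGen.rel _ _ (Or.inl rfl)

theorem circleSetoid_reconnect (σ : D.State) (d : Dart C) :
    D.circleSetoid σ d (d.1, (σ d.1).reconnect d.2) :=
  Relation.EqvGen.rel _ _ (Or.inr rfl)

/-- A resolution connects neighboring ends only, so any two opposite ends represent the two strands
of the segment. -/
theorem segmentEnds_isDiag_iff (σ : D.State) (c : C) (i : ZMod 4) :
    (D.segmentEnds σ c).IsDiag ↔ D.circleSetoid σ (c, i) (c, i + 2) := by
  have h : (D.segmentEnds σ c).IsDiag ↔ D.circleSetoid σ (c, 0) (c, 2) := Quotient.eq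
  have hr : ∀ j, D.circleSetoid σ (c, j) (c, (σ c).reconnect j) :=
    fun j => circleSetoid_reconnect σ (c, j)
  have hreconnect : (i = 0 ∧ i + 2 = 2) ∨ (i = 2 ∧ i + 2 = 0) ∨
      ((σ c).reconnect 0 = i ∧ (σ c).reconnect 2 = i + 2) ∨
      ((σ c).reconnect 2 = i ∧ (σ c).reconnect 0 = i + 2) := by
    generalize σ c = r
    revert i
    cases r <;> decide
  have hiff : D.circleSetoid σ (c, 0) (c, 2) ↔
      D.circleSetoid σ (c, (σ c).reconnect 0) (c, (σ c).reconnect 2) :=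
    ⟨fun k => Setoid.trans' _ (Setoid.symm' _ (hr 0)) (Setoid.trans' _ k (hr 2)),
      fun k => Setoid.trans' _ (hr 0) (Setoid.trans' _ k (Setoid.symm' _ (hr 2)))⟩
  rw [h]
  rcases hreconnect with ⟨e, e'⟩ | ⟨e, e'⟩ | ⟨e, e'⟩ | ⟨e, e'⟩
  · rw [e', e]
  · rw [e', e]
    exact ⟨Setoid.symm' _, Setoid.symm' _⟩
  · rw [hiff, e, e']
  · rw [hiff, e, e']
    exact ⟨Setoid.symm' _, Setoid.symm' _⟩

namespace Checkerboard

variable (κ : D.Checkerboard)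

/-- Membership in `E_σ` means that the resolution joins the black corners, that is, attaches the
band. The sign fixes which ends are white, and the formulas are checked there. -/
theorem reconnect_eq_turn (σ : D.State) {d : Dart C} (hd : ¬ κ.IsBlack d) :
    (d.1, (σ d.1).reconnect d.2) = turn (κ.edgeSubset σ) d := by
  obtain ⟨c, j⟩ := d
  have hpos : κ.IsBlack (c, 1) → j = 0 ∨ j = 2 := fun h => by
    have := κ.eq_of_isBlack_of_not_isBlack h hd
    clear h hd
    revert j
    decide
  have hneg : ¬ κ.IsBlack (c, 1) → j = 1 ∨ j = 3 := fun h => by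
    have := κ.eq_of_isBlack_of_not_isBlack (i := 1 + 1) ((κ.isBlack_rot (c, 1)).2 h) hd
    clear h hd hpos
    revert j
    decide
  by_cases hc : c ∈ κ.edgeSubset σ
  · rw [turn_of_mem hc]
    refine congrArg (Prod.mk c) (?_ : (σ c).reconnect j = j + 1)
    rcases hc with ⟨h, e⟩ | ⟨h, e⟩ <;> rw [e]
    · rcases hpos h with rfl | rfl <;> decide
    · rcases hneg h with rfl | rfl <;> decide
  · rw [turn_of_notMem hc]
    refine congrArg (Prod.mk c) (?_ : (σ c).reconnect j = j + -1)
    by_cases h : κ.IsBlack (c, 1)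
    · have e : σ c = .B := by
        cases e : σ c
        · exact absurd (Or.inl ⟨h, e⟩) hc
        · rfl
      rw [e]
      rcases hpos h with rfl | rfl <;> decide
    · have e : σ c = .A := by
        cases e : σ c
        · rfl
        · exact absurd (Or.inr ⟨h, e⟩) hc
      rw [e]
      rcases hneg h with rfl | rfl <;> decide

open Classical in
/-- The direction, with black on the left, of the edge to which a strand end belongs. -/
noncomputable def toBlack (d : Dart C) : κ.BlackDart :=
  if h : κ.IsBlack d then ⟨d, h⟩ else ⟨D.arc d, (κ.isBlack_arc d).2 h⟩

theorem toBlack_of_isBlack {d : Dart C} (h : κ.IsBlack d) : κ.toBlack d = ⟨d, h⟩ := dif_pos h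

theorem toBlack_of_not_isBlack {d : Dart C} (h : ¬ κ.IsBlack d) :
    κ.toBlack d = ⟨D.arc d, (κ.isBlack_arc d).2 h⟩ := dif_neg h

theorem toBlack_arc (d : Dart C) : κ.toBlack (D.arc d) = κ.toBlack d := by
  by_cases h : κ.IsBlack d
  · rw [κ.toBlack_of_isBlack h, κ.toBlack_of_not_isBlack fun k => (κ.isBlack_arc d).1 k h]
    exact Subtype.ext (D.arc_arc d)
  · rw [κ.toBlack_of_not_isBlack h, κ.toBlack_of_isBlack ((κ.isBlack_arc d).2 h)]

variable [Finite C]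

/-- The state circles are the boundary curves of the black surface with bands `E_σ`. -/
theorem sameCycle_walk_edgeSubset_iff (σ : D.State) (b b' : κ.BlackDart) :
    (κ.walk (κ.edgeSubset σ)).SameCycle b b' ↔ D.circleSetoid σ b.1 b'.1 := by
  constructor
  · have key : Equiv.Perm.SameCycle.setoid (κ.walk (κ.edgeSubset σ)) ≤
        (D.circleSetoid σ).comap Subtype.val := by
      refine Equiv.Perm.sameCycle_le_of_apply fun b => ?_
      change D.circleSetoid σ b.1 (turn _ (D.arc b.1))
      rw [← κ.reconnect_eq_turn σ fun k => (κ.isBlack_arc b.1).1 k b.2]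
      exact Setoid.trans' _ (circleSetoid_arc σ b.1) (circleSetoid_reconnect σ _)
    exact fun h => key h
  · have hwhite : ∀ d, ¬ κ.IsBlack d → (κ.walk (κ.edgeSubset σ)).SameCycle (κ.toBlack d)
        (κ.toBlack (d.1, (σ d.1).reconnect d.2)) := by
      intro d hd
      have e : κ.toBlack (d.1, (σ d.1).reconnect d.2) =
          κ.walk (κ.edgeSubset σ) (κ.toBlack d) := by
        rw [κ.reconnect_eq_turn σ hd, κ.toBlack_of_isBlack ((κ.isBlack_turn _ d).2 hd)]
        refine Subtype.ext ?_
        rw [walk_apply_val, κ.toBlack_of_not_isBlack hd, D.arc_arc]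
      rw [e, Equiv.Perm.sameCycle_apply_right]
    have key : D.circleSetoid σ ≤
        (Equiv.Perm.SameCycle.setoid (κ.walk (κ.edgeSubset σ))).comap κ.toBlack := by
      refine Setoid.eqvGen_le ?_
      rintro d _ (rfl | rfl)
      · change (κ.walk _).SameCycle _ _
        rw [κ.toBlack_arc]
      · change (κ.walk _).SameCycle _ _
        -- Reconnection is an involution that changes color, so the black case is the white case
        -- read backwards.
        by_cases hd : κ.IsBlack d
        · have hinv : ∀ (r : Resolution) (i : ZMod 4), r.reconnect (r.reconnect i) = i := by
            rintro (_ | _) i <;> simp [Resolution.reconnect]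
          have hd' : ¬ κ.IsBlack (d.1, (σ d.1).reconnect d.2) := fun k => by
            have hne : ∀ (r : Resolution) (i : ZMod 4), ¬ (r.reconnect i = i ∨
                r.reconnect i = i + 2) := by
              rintro (_ | _) <;> decide
            exact hne _ _ (κ.black_unique d.1 hd k)
          have := hwhite _ hd'
          rw [hinv] at this
          exact this.symm
        · exact hwhite d hd
    intro h
    have := key h
    rwa [Setoid.comap_rel, κ.toBlack_of_isBlack b.2, κ.toBlack_of_isBlack b'.2] at this

theorem isAdequate_iff (σ : D.State) : D.IsAdequate σ ↔
    ∀ c i (hi : κ.IsBlack (c, i)) (hi' : κ.IsBlack (c, i + 2)),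
      ¬ (κ.walk (κ.edgeSubset σ)).SameCycle ⟨(c, i), hi⟩ ⟨(c, i + 2), hi'⟩ := by
  simp_rw [sameCycle_walk_edgeSubset_iff]
  constructor
  · intro h c i _ _
    rw [← segmentEnds_isDiag_iff]
    exact h c
  · intro h c
    obtain ⟨i, hi, hi'⟩ := κ.exists_black c
    rw [segmentEnds_isDiag_iff σ c i]
    exact h c i hi hi'

/-- A product in `ℤ[t]` is nonzero iff both factors are: no edge of `E_σ` is a bridge of `G|E_σ`,
and no other edge becomes a loop in `G/E_σ`. -/
theorem phi_ne_zero_iff (σ : D.State) : κ.phi σ ≠ 0 ↔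
    ∀ c i, κ.IsBlack (c, i) → κ.IsBlack (c, i + 2) →
      (c ∈ κ.edgeSubset σ → (κ.tait.restrict (κ.edgeSubset σ \ {c})).reachSetoid
        (D.region (c, i)) (D.region (c, i + 2))) ∧
      (c ∉ κ.edgeSubset σ → ¬ (κ.tait.restrict (κ.edgeSubset σ)).reachSetoid
        (D.region (c, i)) (D.region (c, i + 2))) := by
  have hE : (κ.tait.restrict (κ.edgeSubset σ)).edgeSet = κ.edgeSubset σ := Set.univ_inter _
  rw [phi, mul_ne_zero_iff, Graph.aeval_zero_X_tutte_ne_zero_iff,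
    Graph.aeval_X_zero_tutte_ne_zero_iff, hE]
  have hR : ∀ c, (κ.tait.restrict (κ.edgeSubset σ)).restrict (κ.edgeSubset σ \ {c}) =
      κ.tait.restrict (κ.edgeSubset σ \ {c}) := fun c => by
    rw [Graph.restrict_restrict, Set.inter_eq_right.2 Set.sdiff_subset]
  constructor
  · rintro ⟨h1, h2⟩ c i hi hi'
    have hl := κ.isLink_tait hi hi'
    refine ⟨fun hc => ?_, fun hc hr => ?_⟩
    · rw [← hR]
      exact h1 c _ _ ⟨hc, hl⟩
    · exact h2 c _ ((Graph.contractEdges_isLink _).2 ⟨hc, _, _, hl, Quotient.sound hr, rfl⟩)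
  · intro h
    constructor
    · intro c x y hl
      obtain ⟨hc, i, rfl, rfl, hi, hi'⟩ := hl
      rw [hR]
      exact (h c i hi hi').1 hc
    · intro c p hl
      obtain ⟨hc, _, _, ⟨i, rfl, rfl, hi, hi'⟩, e, rfl⟩ := (Graph.contractEdges_isLink _).1 hl
      exact (h c i hi hi').2 hc (Quotient.exact e)

end Checkerboard

end LinkDiagram

theorem theorem1p2 {C : Type*} [Nonempty C] (D : LinkDiagram C) (hD : D.Connected)
    (κ : D.Checkerboard) (σ : D.State) :
    D.IsAdequate σ ↔ κ.phi σ ≠ 0 := by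
  have := D.finite_crossings
  rw [κ.isAdequate_iff, κ.phi_ne_zero_iff]
  refine forall₂_congr fun c i => forall₂_congr fun hi hi' => ?_
  -- For `c ∈ E_σ` the genus-zero criterion is applied to `E_σ \ {c}`, before the band at `c` is put
  -- back.
  by_cases hc : c ∈ κ.edgeSubset σ
  · have h := κ.sameCycle_walk_insert_iff hD (A := κ.edgeSubset σ \ {c}) (fun k => k.2 rfl) hi hi'
    rw [Set.insert_sdiff_singleton, Set.insert_eq_of_mem hc] at h
    tauto
  · have h := κ.sameCycle_walk_iff_reachSetoid hD hc hi hi'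
    tauto
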